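/- Let $n\ge 2$, let $\Omega\subset\mathbb{R}^n$ be a bounded domain (non-empty, open, connected) with volume $|\Omega|$, and let $l\ge 1$ be an integer. Let $0<\lambda_1\le\lambda_2\le\cdots$ be the eigenvalues, repeated according to multiplicity, of the Dirichlet problem for the polyharmonic operator $$(-\Delta)^l u=\lambda u \ \text{ in } \Omega,\qquad u=\frac{\partial u}{\partial\nu}=\cdots=\frac{\partial^{l-1}u}{\partial\nu^{l-1}}=0\ \text{ on }\partial\Omega,$$ understood weakly: $u\in H^l_0(\Omega)\setminus\{0\}$ and the equation holds in the sense of distributions on $\Omega$. Then for every $0<q\le 1$ and every integer $k\ge 0$, $$\sum_{j=1}^k\lambda_j^{\,q}\ \ge\ \frac{n}{n+2lq}\,(4\pi)^{lq}\left(\frac{\Gamma(1+\frac n2)}{|\Omega|}\right)^{\frac{2lq}{n}}k^{1+\frac{2lq}{n}}.$$ -/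

import Mathlib

open MeasureTheory Filter Topology TopologicalSpace
open scoped ENNReal Distributions LineDeriv Laplacian

noncomputable section

namespace Polyharmonic

/-- The complex Hilbert space `L²(Ω)` of an open set `Ω ⊆ ℝⁿ` (Lebesgue measure). -/
abbrev L2 {n : ℕ} (Ω : Opens (EuclideanSpace ℝ (Fin n))) : Type :=
  Lp ℂ 2 ((volume : Measure (EuclideanSpace ℝ (Fin n))).restrict Ω)

/-- The partial derivative `∂_{α 0} ∂_{α 1} ⋯ ∂_{α (m-1)} φ` of a test function `φ ∈ C_c^∞(Ω)`,
where `∂_i` is the derivative along the `i`-th coordinate vector. -/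
def partialDeriv {n m : ℕ} {Ω : Opens (EuclideanSpace ℝ (Fin n))}
    (α : Fin m → Fin n) (φ : 𝓓(Ω, ℂ)) : 𝓓(Ω, ℂ) :=
  ∂^{fun i => EuclideanSpace.single (α i) (1 : ℝ)} φ

/-- `v` is the weak partial derivative `∂_{α 0} ⋯ ∂_{α (m-1)} u` of `u` on `Ω`. -/
def IsWeakPartialDeriv {n m : ℕ} {Ω : Opens (EuclideanSpace ℝ (Fin n))}
    (α : Fin m → Fin n) (u v : L2 Ω) : Prop :=
  ∀ φ : 𝓓(Ω, ℂ),
    ∫ x in Ω, u x * partialDeriv α φ x = (-1 : ℂ) ^ m * ∫ x in Ω, v x * φ x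

/-- `u ∈ H₀ˡ(Ω)`: the weak derivatives of `u` of all orders `m ≤ l` exist in `L²(Ω)`, and `u` is a
limit of functions of `C_c^∞(Ω)` in the norm of `Hˡ(Ω)`, that is, all partial derivatives
of order `m ≤ l` of these functions converge in `L²(Ω)` to those of `u`. -/
def MemH0 {n : ℕ} {Ω : Opens (EuclideanSpace ℝ (Fin n))} (l : ℕ) (u : L2 Ω) : Prop :=
  ∃ v : (m : ℕ) → (Fin m → Fin n) → L2 Ω,
    (∀ m ≤ l, ∀ α : Fin m → Fin n, IsWeakPartialDeriv α u (v m α)) ∧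
    ∃ φ : ℕ → 𝓓(Ω, ℂ), ∀ m ≤ l, ∀ α : Fin m → Fin n,
      Tendsto (fun i => eLpNorm (fun x => partialDeriv α (φ i) x - v m α x) 2
        ((volume : Measure (EuclideanSpace ℝ (Fin n))).restrict Ω)) atTop (𝓝 0)

/-- The operator `(-Δ)ˡ` on functions `ℝⁿ → ℂ` (applied to smooth functions only). -/
def negLaplacianPow {n : ℕ} (l : ℕ) (f : EuclideanSpace ℝ (Fin n) → ℂ) :
    EuclideanSpace ℝ (Fin n) → ℂ :=
  (fun g : EuclideanSpace ℝ (Fin n) → ℂ => -Δ g)^[l] f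

/-- `u` is an eigenfunction with eigenvalue `ν` of the Dirichlet problem
`(-Δ)ˡ u = ν u` in `Ω`, with `u` and its normal derivatives of order at most `l - 1` vanishing on
`∂Ω`: the boundary conditions mean `u ∈ H₀ˡ(Ω)`, and the equation holds in the sense of distributions on `Ω`. -/
def IsDirichletEigenfunction {n : ℕ} {Ω : Opens (EuclideanSpace ℝ (Fin n))}
    (l : ℕ) (ν : ℝ) (u : L2 Ω) : Prop :=
  u ≠ 0 ∧ MemH0 l u ∧
    ∀ φ : 𝓓(Ω, ℂ),
      ∫ x in Ω, u x * negLaplacianPow l φ x = (ν : ℂ) * ∫ x in Ω, u x * φ x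

/-- The `k`-th Dirichlet eigenvalue `λ_k` (`k ≥ 1`) of `(-Δ)ˡ` on `Ω`, counted with multiplicity:
the least `μ` such that there are `k` linearly independent eigenfunctions with eigenvalues at
most `μ` (and `∞` if there is no such `μ`). -/
def dirichletEigenvalue {n : ℕ} (Ω : Opens (EuclideanSpace ℝ (Fin n))) (l k : ℕ) : ℝ≥0∞ :=
  ⨅ (μ : ℝ) (_ : ∃ u : Fin k → L2 Ω, LinearIndependent ℂ u ∧
    ∀ i, ∃ ν ≤ μ, IsDirichletEigenfunction l ν (u i)), ENNReal.ofReal μ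

end Polyharmonic

end

/-! This is the Berezin–Li–Yau argument on the Fourier side. Let `u j` be orthonormal eigenfunctions
with eigenvalues `ν j`. By Plancherel, `ρ_j = |û_j|²` is a probability density on `ℝⁿ`, and its
moment `∫ |2πξ|^(2l) ρ_j` is `ν j` (`lintegral_energy_of_mem_eigenspace`). Since `t ↦ t ^ q` is
concave, Jensen gives `∫ |2πξ|^(2lq) ρ_j ≤ (ν j) ^ q` (`lintegral_rpow_mul_le`).

The sum `F = ∑ ρ_j` has mass `k`. Moreover `û_j(ξ)` is the inner product of `u j` with a plane wave
of squared norm `|Ω|`, so Bessel gives `F ≤ |Ω|` everywhere (`sum_enorm_fourierL2_sq_le`). Under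
these two constraints the weighted mass of `F` is least when `F` equals `|Ω|` on a centred ball of
volume `k / |Ω|` and vanishes outside (`mul_setLIntegral_le_lintegral_mul`). Integrating the weight
over this ball gives the constant.

An eigenvalue is an infimum over families of independent eigenfunctions, and is infinite when there
are none. Hence neither compactness nor a complete eigenbasis is needed: orthogonality of distinct
eigenspaces suffices to extract an orthonormal family (`exists_orthonormal_eigenfunctions`). -/

noncomputable section

namespace Polyharmonic

open SchwartzMap FourierTransform

/-! ### Fourier symbols of partial derivatives and of the polyharmonic operator -/

/-- The symbol `∏ⱼ 2πi ξ_{α j}` of the partial derivative `∂_{α 0} ⋯ ∂_{α (m-1)}`. -/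
def symbol {n m : ℕ} (α : Fin m → Fin n) (ξ : EuclideanSpace ℝ (Fin n)) : ℂ :=
  ∏ j, (2 * Real.pi * Complex.I * (ξ (α j) : ℂ))

theorem schwartz_sum_apply {n : ℕ} {ι : Type*} (s : Finset ι)
    (f : ι → 𝓢(EuclideanSpace ℝ (Fin n), ℂ)) (x : EuclideanSpace ℝ (Fin n)) :
    (∑ i ∈ s, f i) x = ∑ i ∈ s, f i x := by
  classical
  induction s using Finset.induction_on with
  | empty => simp
  | insert a s ha ih => rw [Finset.sum_insert ha, Finset.sum_insert ha, add_apply, ih]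

theorem fourier_lineDerivOp_single {n : ℕ} (i : Fin n)
    (f : 𝓢(EuclideanSpace ℝ (Fin n), ℂ)) (ξ : EuclideanSpace ℝ (Fin n)) :
    𝓕 (∂_{EuclideanSpace.single i (1 : ℝ)} f) ξ =
      2 * Real.pi * Complex.I * (ξ i : ℂ) * 𝓕 f ξ := by
  rw [fourier_lineDerivOp_eq]
  have hg : (inner ℝ · (EuclideanSpace.single i (1 : ℝ)) :
      EuclideanSpace ℝ (Fin n) → ℝ).HasTemperateGrowth :=
    ((innerSL ℝ).flip _).hasTemperateGrowth
  rw [smul_apply, smulLeftCLM_apply_apply hg]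
  simp [EuclideanSpace.inner_single_right]
  ring

theorem fourier_iteratedLineDerivOp_single {n m : ℕ} (α : Fin m → Fin n)
    (f : 𝓢(EuclideanSpace ℝ (Fin n), ℂ)) (ξ : EuclideanSpace ℝ (Fin n)) :
    𝓕 (∂^{fun i => EuclideanSpace.single (α i) (1 : ℝ)} f) ξ = symbol α ξ * 𝓕 f ξ := by
  induction m with
  | zero => simp [symbol]
  | succ m ih =>
    rw [LineDeriv.iteratedLineDerivOp_succ_left, fourier_lineDerivOp_single,
      show Fin.tail (fun i => EuclideanSpace.single (α i) (1 : ℝ)) =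
        fun i => EuclideanSpace.single (Fin.tail α i) (1 : ℝ) from rfl, ih (Fin.tail α)]
    simp only [symbol, Fin.prod_univ_succ, Fin.tail]
    ring

/-- Expanding the `l`-th power of a sum over coordinates gives one term per ordered `l`-tuple, so
indexing by tuples instead of multi-indices avoids multinomial coefficients. -/
theorem sum_symbol_sq {n : ℕ} (l : ℕ) (ξ : EuclideanSpace ℝ (Fin n)) :
    ∑ α : Fin l → Fin n, symbol α ξ ^ 2 = (-((2 * Real.pi) ^ 2 * ‖ξ‖ ^ 2 : ℝ)) ^ l := by
  simp only [symbol, ← Finset.prod_pow]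
  rw [← Fintype.sum_pow (fun i => (2 * Real.pi * Complex.I * (ξ i : ℂ)) ^ 2) l,
    EuclideanSpace.norm_sq_eq]
  congr 1
  simp [mul_pow, Finset.mul_sum]

theorem sum_norm_symbol_sq {n : ℕ} (l : ℕ) (ξ : EuclideanSpace ℝ (Fin n)) :
    ∑ α : Fin l → Fin n, ‖symbol α ξ‖ ^ 2 = (2 * Real.pi * ‖ξ‖) ^ (2 * l) := by
  simp only [symbol, norm_prod, ← Finset.prod_pow]
  rw [← Fintype.sum_pow (fun i => ‖2 * Real.pi * Complex.I * (ξ i : ℂ)‖ ^ 2) l, pow_mul,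
    mul_pow, EuclideanSpace.norm_sq_eq]
  congr 1
  simp [mul_pow, Finset.mul_sum, abs_of_pos Real.pi_pos]

theorem fourier_laplacian {n : ℕ} (f : 𝓢(EuclideanSpace ℝ (Fin n), ℂ))
    (ξ : EuclideanSpace ℝ (Fin n)) :
    𝓕 (Δ f) ξ = (-((2 * Real.pi) ^ 2 * ‖ξ‖ ^ 2 : ℝ)) * 𝓕 f ξ := by
  rw [laplacian_eq_sum (EuclideanSpace.basisFun (Fin n) ℝ), FourierTransform.fourier_sum,
    schwartz_sum_apply, EuclideanSpace.norm_sq_eq]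
  simp only [EuclideanSpace.basisFun_apply, fourier_lineDerivOp_single]
  simp only [Finset.mul_sum, Complex.ofReal_sum, Complex.ofReal_mul, ← Finset.sum_neg_distrib,
    Finset.sum_mul]
  refine Finset.sum_congr rfl fun i _ => ?_
  simp only [Real.norm_eq_abs, sq_abs]
  push_cast
  linear_combination (4 * Real.pi ^ 2 * (ξ i : ℂ) ^ 2 * 𝓕 f ξ) * Complex.I_sq

theorem fourier_iterate_neg_laplacian {n : ℕ} (l : ℕ) (f : 𝓢(EuclideanSpace ℝ (Fin n), ℂ))
    (ξ : EuclideanSpace ℝ (Fin n)) :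
    𝓕 ((fun g : 𝓢(EuclideanSpace ℝ (Fin n), ℂ) => -Δ g)^[l] f) ξ =
      ((2 * Real.pi) ^ 2 * ‖ξ‖ ^ 2 : ℝ) ^ l * 𝓕 f ξ := by
  induction l with
  | zero => simp
  | succ l ih =>
    rw [Function.iterate_succ_apply', FourierTransform.fourier_neg, neg_apply, fourier_laplacian,
      ih]
    ring

/-- The expansion `(-Δ)ˡ = (-1)ˡ ∑_α ∂^α ∂^α`, over all `l`-tuples `α` of coordinates. -/
theorem iterate_neg_laplacian_eq_sum {n : ℕ} (l : ℕ) (f : 𝓢(EuclideanSpace ℝ (Fin n), ℂ)) :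
    (fun g : 𝓢(EuclideanSpace ℝ (Fin n), ℂ) => -Δ g)^[l] f =
      (-1 : ℂ) ^ l • ∑ α : Fin l → Fin n,
        ∂^{fun i => EuclideanSpace.single (α i) (1 : ℝ)}
          (∂^{fun i => EuclideanSpace.single (α i) (1 : ℝ)} f) := by
  -- The Fourier transform is injective on Schwartz functions, so it is enough to compare symbols.
  apply (fourierEquiv ℂ 𝓢(EuclideanSpace ℝ (Fin n), ℂ)).injective
  ext ξ
  rw [fourierEquiv_apply, fourierEquiv_apply, fourier_iterate_neg_laplacian,
    FourierTransform.fourier_smul, FourierTransform.fourier_sum, smul_apply, schwartz_sum_apply]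
  simp only [fourier_iteratedLineDerivOp_single, ← mul_assoc, ← sq]
  rw [← Finset.sum_mul, sum_symbol_sq, smul_eq_mul, ← mul_assoc]
  congr 1
  exact (fun a => by rw [← mul_pow, neg_one_mul, neg_neg] :
    ∀ a : ℂ, a ^ l = (-1) ^ l * (-a) ^ l) _

/-! ### Test functions as Schwartz functions, and their conjugates -/

/-- A test function as a Schwartz function. -/
def toSchwartz {n : ℕ} {Ω : Opens (EuclideanSpace ℝ (Fin n))} (φ : 𝓓(Ω, ℂ)) :
    𝓢(EuclideanSpace ℝ (Fin n), ℂ) :=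
  φ.hasCompactSupport.toSchwartzMap φ.contDiff

@[simp]
theorem toSchwartz_apply {n : ℕ} {Ω : Opens (EuclideanSpace ℝ (Fin n))} (φ : 𝓓(Ω, ℂ))
    (x : EuclideanSpace ℝ (Fin n)) : toSchwartz φ x = φ x := rfl

theorem lineDerivOp_apply {n : ℕ} {Ω : Opens (EuclideanSpace ℝ (Fin n))} (φ : 𝓓(Ω, ℂ))
    (v x : EuclideanSpace ℝ (Fin n)) : (∂_{v} φ) x = lineDeriv ℝ φ x v := by
  rw [TestFunction.lineDerivOp_eq_lineDerivCLM ℝ]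
  exact TestFunction.lineDerivCLM_apply_of_le (by simp)

theorem toSchwartz_lineDerivOp {n : ℕ} {Ω : Opens (EuclideanSpace ℝ (Fin n))} (φ : 𝓓(Ω, ℂ))
    (v : EuclideanSpace ℝ (Fin n)) : toSchwartz (∂_{v} φ) = ∂_{v} (toSchwartz φ) := by
  ext x
  rw [SchwartzMap.lineDerivOp_apply, toSchwartz_apply, lineDerivOp_apply]
  rfl

theorem toSchwartz_partialDeriv {n m : ℕ} {Ω : Opens (EuclideanSpace ℝ (Fin n))}
    (α : Fin m → Fin n) (φ : 𝓓(Ω, ℂ)) :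
    toSchwartz (partialDeriv α φ) =
      ∂^{fun i => EuclideanSpace.single (α i) (1 : ℝ)} (toSchwartz φ) := by
  induction m with
  | zero => rfl
  | succ m ih =>
    rw [LineDeriv.iteratedLineDerivOp_succ_left]
    exact (toSchwartz_lineDerivOp _ _).trans (congrArg _ (ih (Fin.tail α)))

theorem negLaplacianPow_schwartz {n : ℕ} (l : ℕ) (f : 𝓢(EuclideanSpace ℝ (Fin n), ℂ)) :
    negLaplacianPow l f = ((fun g : 𝓢(EuclideanSpace ℝ (Fin n), ℂ) => -Δ g)^[l] f) := by
  unfold negLaplacianPow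
  induction l with
  | zero => rfl
  | succ l ih =>
    rw [Function.iterate_succ_apply', Function.iterate_succ_apply', ih]
    ext x
    rw [Pi.neg_apply, neg_apply, SchwartzMap.laplacian_apply]

theorem negLaplacianPow_eq_sum {n : ℕ} {Ω : Opens (EuclideanSpace ℝ (Fin n))} (l : ℕ)
    (φ : 𝓓(Ω, ℂ)) (x : EuclideanSpace ℝ (Fin n)) :
    negLaplacianPow l φ x =
      (-1 : ℂ) ^ l * ∑ α : Fin l → Fin n, partialDeriv α (partialDeriv α φ) x := by
  have h := congrFun (negLaplacianPow_schwartz l (toSchwartz φ)) x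
  rw [iterate_neg_laplacian_eq_sum, smul_apply, schwartz_sum_apply] at h
  simp only [← toSchwartz_partialDeriv] at h
  exact h

/-- The complex conjugate of a test function. -/
def conjTest {n : ℕ} {Ω : Opens (EuclideanSpace ℝ (Fin n))} (φ : 𝓓(Ω, ℂ)) : 𝓓(Ω, ℂ) :=
  TestFunction.postcompCLM (Complex.conjCLE : ℂ →L[ℝ] ℂ) φ

theorem conjTest_apply {n : ℕ} {Ω : Opens (EuclideanSpace ℝ (Fin n))} (φ : 𝓓(Ω, ℂ))
    (x : EuclideanSpace ℝ (Fin n)) : conjTest φ x = starRingEnd ℂ (φ x) := rfl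

theorem lineDerivOp_conjTest {n : ℕ} {Ω : Opens (EuclideanSpace ℝ (Fin n))} (φ : 𝓓(Ω, ℂ))
    (v : EuclideanSpace ℝ (Fin n)) : ∂_{v} (conjTest φ) = conjTest (∂_{v} φ) := by
  ext x
  have hd : DifferentiableAt ℝ φ x := (φ.contDiff.differentiable (by simp)).differentiableAt
  rw [conjTest_apply, lineDerivOp_apply, lineDerivOp_apply]
  have h := hd.hasFDerivAt.hasLineDerivAt v
  have h2 : HasLineDerivAt ℝ (conjTest φ) (starRingEnd ℂ (fderiv ℝ φ x v)) x v :=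
    ((Complex.conjCLE : ℂ →L[ℝ] ℂ).hasFDerivAt.comp x hd.hasFDerivAt).hasLineDerivAt v
  rw [h.lineDeriv, h2.lineDeriv]

theorem partialDeriv_conjTest {n m : ℕ} {Ω : Opens (EuclideanSpace ℝ (Fin n))}
    (α : Fin m → Fin n) (φ : 𝓓(Ω, ℂ)) :
    partialDeriv α (conjTest φ) = conjTest (partialDeriv α φ) := by
  induction m with
  | zero => rfl
  | succ m ih =>
    exact (congrArg _ (ih (Fin.tail α))).trans (lineDerivOp_conjTest _ _)

/-! ### Weak derivatives and `H₀ˡ(Ω)` in terms of the inner product of `L²(Ω)` -/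

section

variable {n : ℕ} {Ω : Opens (EuclideanSpace ℝ (Fin n))}

theorem memLp_testFunction (φ : 𝓓(Ω, ℂ)) :
    MemLp φ 2 ((volume : Measure (EuclideanSpace ℝ (Fin n))).restrict Ω) :=
  (φ.continuous.memLp_of_hasCompactSupport φ.hasCompactSupport).restrict _

/-- A test function as an element of `L²(Ω)`. -/
def toL2 (φ : 𝓓(Ω, ℂ)) : L2 Ω := (memLp_testFunction φ).toLp

theorem coeFn_toL2 (φ : 𝓓(Ω, ℂ)) :
    toL2 φ =ᵐ[(volume : Measure (EuclideanSpace ℝ (Fin n))).restrict Ω] φ :=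
  (memLp_testFunction φ).coeFn_toLp

theorem toL2_add (φ ψ : 𝓓(Ω, ℂ)) : toL2 (φ + ψ) = toL2 φ + toL2 ψ := rfl

theorem toL2_sub (φ ψ : 𝓓(Ω, ℂ)) : toL2 (φ - ψ) = toL2 φ - toL2 ψ := rfl

theorem toL2_smul (c : ℂ) (φ : 𝓓(Ω, ℂ)) : toL2 (c • φ) = c • toL2 φ := rfl

theorem norm_toLp_toSchwartz (φ : 𝓓(Ω, ℂ)) : ‖(toSchwartz φ).toLp 2‖ = ‖toL2 φ‖ := by
  rw [SchwartzMap.norm_toLp, toL2, Lp.norm_toLp]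
  congr 1
  exact (eLpNorm_restrict_eq_of_support_subset
    ((subset_tsupport _).trans φ.tsupport_subset)).symm

theorem tendsto_toL2_iff (φ : ℕ → 𝓓(Ω, ℂ)) (v : L2 Ω) :
    Tendsto (fun i => eLpNorm (fun x => φ i x - v x) 2
        ((volume : Measure (EuclideanSpace ℝ (Fin n))).restrict Ω)) atTop (𝓝 0) ↔
      Tendsto (fun i => toL2 (φ i)) atTop (𝓝 v) := by
  rw [Lp.tendsto_Lp_iff_tendsto_eLpNorm']
  refine tendsto_congr fun i => eLpNorm_congr_ae ?_
  filter_upwards [coeFn_toL2 (φ i)] with x hx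
  simp [hx]

/-- The weak formulations pair bilinearly, while the inner product is conjugate-linear in its first
argument; the conjugate compensates. -/
theorem integral_mul_eq_inner (u : L2 Ω) (φ : 𝓓(Ω, ℂ)) :
    ∫ x in Ω, u x * φ x = inner ℂ (toL2 (conjTest φ)) u := by
  rw [L2.inner_def]
  refine integral_congr_ae ?_
  filter_upwards [coeFn_toL2 (conjTest φ)] with x hx
  simp [hx, conjTest_apply]

theorem conjTest_conjTest (φ : 𝓓(Ω, ℂ)) : conjTest (conjTest φ) = φ := by
  ext x
  simp [conjTest_apply]

theorem isWeakPartialDeriv_iff {m : ℕ} (α : Fin m → Fin n) (u v : L2 Ω) :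
    IsWeakPartialDeriv α u v ↔ ∀ φ : 𝓓(Ω, ℂ),
      inner ℂ (toL2 (partialDeriv α φ)) u = (-1 : ℂ) ^ m * inner ℂ (toL2 φ) v := by
  simp only [IsWeakPartialDeriv, integral_mul_eq_inner, ← partialDeriv_conjTest]
  exact ⟨fun h φ => by simpa only [conjTest_conjTest] using h (conjTest φ),
    fun h φ => h (conjTest φ)⟩

theorem integral_mul_negLaplacianPow (l : ℕ) (u : L2 Ω) (φ : 𝓓(Ω, ℂ)) :
    ∫ x in Ω, u x * negLaplacianPow l φ x =
      (-1 : ℂ) ^ l * ∑ α : Fin l → Fin n,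
        inner ℂ (toL2 (partialDeriv α (partialDeriv α (conjTest φ)))) u := by
  simp only [partialDeriv_conjTest, ← integral_mul_eq_inner]
  rw [← integral_finsetSum, ← integral_const_mul]
  · refine integral_congr_ae (.of_forall fun x => ?_)
    simp only [negLaplacianPow_eq_sum, Finset.mul_sum]
    exact Finset.sum_congr rfl fun α _ => by ring
  · intro α _
    exact (Lp.memLp u).integrable_mul (memLp_testFunction _)

theorem memH0_iff (l : ℕ) (u : L2 Ω) :
    MemH0 l u ↔ ∃ v : (m : ℕ) → (Fin m → Fin n) → L2 Ω,
      (∀ m ≤ l, ∀ α : Fin m → Fin n, IsWeakPartialDeriv α u (v m α)) ∧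
      ∃ φ : ℕ → 𝓓(Ω, ℂ), ∀ m ≤ l, ∀ α : Fin m → Fin n,
        Tendsto (fun i => toL2 (partialDeriv α (φ i))) atTop (𝓝 (v m α)) := by
  simp only [MemH0, tendsto_toL2_iff]

/-- `MemH0` does not say that the derivative of order zero is `u` itself. The fundamental lemma of
the calculus of variations shows it, real test functions being enough. -/
theorem eq_of_isWeakPartialDeriv_zero (α : Fin 0 → Fin n) {u v : L2 Ω}
    (h : IsWeakPartialDeriv α u v) : v = u := by
  have hint : ∀ w : L2 Ω, LocallyIntegrableOn w Ω
      (volume : Measure (EuclideanSpace ℝ (Fin n))) := fun w => by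
    rw [locallyIntegrableOn_iff Ω.isOpen.isLocallyClosed]
    intro K hK hKc
    have hw := Lp.memLp w
    have : IsFiniteMeasure ((volume : Measure (EuclideanSpace ℝ (Fin n))).restrict K) :=
      ⟨by simpa using hKc.measure_lt_top⟩
    exact (hw.mono_measure (Measure.restrict_mono hK le_rfl)).integrable (by norm_num)
  have key : ∀ᵐ x ∂(volume : Measure (EuclideanSpace ℝ (Fin n))), x ∈ (Ω : Set _) →
      v x - u x = 0 := by
    refine Ω.isOpen.ae_eq_zero_of_integral_contDiff_smul_eq_zero
      ((hint v).sub (hint u)) fun g hg hgc hgs => ?_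
    let φ : 𝓓(Ω, ℂ) := ⟨fun x => (g x : ℂ), Complex.ofRealCLM.contDiff.comp hg,
      hgc.comp_left (g := fun r : ℝ => (r : ℂ)) (by simp),
      (tsupport_comp_subset (g := fun r : ℝ => (r : ℂ)) (by simp) g).trans hgs⟩
    have h1 : ∫ x in Ω, u x * φ x = (-1 : ℂ) ^ 0 * ∫ x in Ω, v x * φ x := h φ
    rw [pow_zero, one_mul] at h1
    have hφ : ∀ x, φ x = (g x : ℂ) := fun x => rfl
    rw [← setIntegral_eq_integral_of_forall_compl_eq_zero (s := (Ω : Set _))]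
    · have h2 : ∫ x in Ω, (v x * φ x - u x * φ x) = 0 :=
        (integral_sub ((Lp.memLp v).integrable_mul (memLp_testFunction φ))
          ((Lp.memLp u).integrable_mul (memLp_testFunction φ))).trans (sub_eq_zero.mpr h1.symm)
      rw [← h2]
      congr 1
      ext x
      simp [hφ]
      ring
    · intro x hx
      have : g x = 0 := image_eq_zero_of_notMem_tsupport fun hxs => hx (hgs hxs)
      simp [this]
  refine Lp.ext ?_
  rw [EventuallyEq, ae_restrict_iff' Ω.isOpen.measurableSet]
  filter_upwards [key] with x hx hxΩ
  exact sub_eq_zero.mp (hx hxΩ)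

/-- The functions of `H₀ˡ(Ω)` come with their derivatives of order `l`, which are limits
of those of approximating test functions. -/
theorem MemH0.exists_approx {l : ℕ} {u : L2 Ω} (hu : MemH0 l u) :
    ∃ (U : (Fin l → Fin n) → L2 Ω) (φ : ℕ → 𝓓(Ω, ℂ)),
      (∀ α, IsWeakPartialDeriv α u (U α)) ∧
      Tendsto (fun i => toL2 (φ i)) atTop (𝓝 u) ∧
      ∀ α, Tendsto (fun i => toL2 (partialDeriv α (φ i))) atTop (𝓝 (U α)) := by
  obtain ⟨v, hv, φ, hφ⟩ := (memH0_iff l u).mp hu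
  refine ⟨v l, φ, hv l le_rfl, ?_, hφ l le_rfl⟩
  have h0 := hφ 0 (Nat.zero_le _) Fin.elim0
  rwa [eq_of_isWeakPartialDeriv_zero _ (hv 0 (Nat.zero_le _) Fin.elim0)] at h0

theorem partialDeriv_add {m : ℕ} (α : Fin m → Fin n) (φ ψ : 𝓓(Ω, ℂ)) :
    partialDeriv α (φ + ψ) = partialDeriv α φ + partialDeriv α ψ :=
  LineDeriv.iteratedLineDerivOp_add _ _ _

theorem partialDeriv_smul {m : ℕ} (α : Fin m → Fin n) (c : ℂ) (φ : 𝓓(Ω, ℂ)) :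
    partialDeriv α (c • φ) = c • partialDeriv α φ :=
  LineDeriv.iteratedLineDerivOp_smul _ _ _

theorem partialDeriv_zero {m : ℕ} (α : Fin m → Fin n) :
    partialDeriv α (0 : 𝓓(Ω, ℂ)) = 0 :=
  LineDeriv.iteratedLineDerivOp_zero _

/-! ### Eigenspaces and their orthogonality -/

variable (Ω) in
/-- The space of weak solutions `u ∈ H₀ˡ(Ω)` of `(-Δ)ˡ u = ν u`. -/
def eigenspace (l : ℕ) (ν : ℝ) : Submodule ℂ (L2 Ω) where
  carrier := {u | MemH0 l u ∧ ∀ φ : 𝓓(Ω, ℂ),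
      ∫ x in Ω, u x * negLaplacianPow l φ x = (ν : ℂ) * ∫ x in Ω, u x * φ x}
  zero_mem' := by
    refine ⟨(memH0_iff l 0).mpr ⟨fun _ _ => 0, fun m _ α => ?_, fun _ => 0, fun m _ α => ?_⟩, ?_⟩
    · simp [isWeakPartialDeriv_iff]
    · simp only [partialDeriv_zero]
      exact tendsto_const_nhds
    · intro φ
      refine (integral_mul_negLaplacianPow l (0 : L2 Ω) φ).trans ?_
      refine Eq.trans ?_ (congrArg _ (integral_mul_eq_inner (0 : L2 Ω) φ).symm)
      simp
  add_mem' := by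
    rintro u w ⟨hu, hu'⟩ ⟨hw, hw'⟩
    obtain ⟨U, hU, φ, hφ⟩ := (memH0_iff l u).mp hu
    obtain ⟨W, hW, ψ, hψ⟩ := (memH0_iff l w).mp hw
    refine ⟨(memH0_iff l _).mpr ⟨fun m α => U m α + W m α, fun m hm α => ?_,
      fun i => φ i + ψ i, fun m hm α => ?_⟩, fun χ => ?_⟩
    · have h1 := (isWeakPartialDeriv_iff _ _ _).mp (hU m hm α)
      have h2 := (isWeakPartialDeriv_iff _ _ _).mp (hW m hm α)
      rw [isWeakPartialDeriv_iff]
      intro χ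
      rw [inner_add_right, inner_add_right, h1, h2]
      ring
    · simp only [partialDeriv_add, toL2_add]
      exact (hφ m hm α).add (hψ m hm α)
    · have h1 := hu' χ
      have h2 := hw' χ
      simp only [integral_mul_negLaplacianPow, integral_mul_eq_inner] at h1 h2 ⊢
      simp only [inner_add_right, Finset.sum_add_distrib, mul_add, h1, h2]
  smul_mem' := by
    rintro c u ⟨hu, hu'⟩
    obtain ⟨U, hU, φ, hφ⟩ := (memH0_iff l u).mp hu
    refine ⟨(memH0_iff l _).mpr ⟨fun m α => c • U m α, fun m hm α => ?_,
      fun i => c • φ i, fun m hm α => ?_⟩, fun χ => ?_⟩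
    · have h1 := (isWeakPartialDeriv_iff _ _ _).mp (hU m hm α)
      rw [isWeakPartialDeriv_iff]
      intro χ
      rw [inner_smul_right, inner_smul_right, h1]
      ring
    · simp only [partialDeriv_smul, toL2_smul]
      exact (hφ m hm α).const_smul c
    · have h1 := hu' χ
      simp only [integral_mul_negLaplacianPow, integral_mul_eq_inner] at h1 ⊢
      simp only [inner_smul_right, ← Finset.mul_sum]
      linear_combination c * h1

/-- The weak equation tested against a function of `H₀ˡ(Ω)`. -/
theorem sum_inner_of_mem_eigenspace {l : ℕ} {ν : ℝ} {u w : L2 Ω} (hu : u ∈ eigenspace Ω l ν)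
    {U W : (Fin l → Fin n) → L2 Ω} {ψ : ℕ → 𝓓(Ω, ℂ)}
    (hU : ∀ α, IsWeakPartialDeriv α u (U α))
    (hψ : Tendsto (fun i => toL2 (ψ i)) atTop (𝓝 w))
    (hψW : ∀ α, Tendsto (fun i => toL2 (partialDeriv α (ψ i))) atTop (𝓝 (W α))) :
    ∑ α, inner ℂ (W α) (U α) = (ν : ℂ) * inner ℂ w u := by
  -- Half of the derivatives are moved onto `u` by its weak derivatives of order `l`; the sign
  -- `(-1)ˡ` occurs twice and cancels.
  have key : ∀ φ : 𝓓(Ω, ℂ), ∑ α, inner ℂ (toL2 (partialDeriv α φ)) (U α) =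
      (ν : ℂ) * inner ℂ (toL2 φ) u := fun φ => by
    have h := hu.2 (conjTest φ)
    rw [integral_mul_negLaplacianPow, integral_mul_eq_inner, conjTest_conjTest] at h
    rw [← h, Finset.mul_sum]
    refine Finset.sum_congr rfl fun α _ => ?_
    rw [(isWeakPartialDeriv_iff _ _ _).mp (hU α), ← mul_assoc, ← mul_pow]
    simp
  have h1 : Tendsto (fun i => ∑ α, inner ℂ (toL2 (partialDeriv α (ψ i))) (U α)) atTop
      (𝓝 (∑ α, inner ℂ (W α) (U α))) :=
    tendsto_finsetSum _ fun α _ => (hψW α).inner tendsto_const_nhds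
  have h2 : Tendsto (fun i => (ν : ℂ) * inner ℂ (toL2 (ψ i)) u) atTop
      (𝓝 ((ν : ℂ) * inner ℂ w u)) := (hψ.inner tendsto_const_nhds).const_mul _
  simp only [key] at h1
  exact tendsto_nhds_unique h1 h2

/-- The energy form `∑ ⟪W α, U α⟫` is Hermitian and the eigenvalues are real, so evaluating it from
either side gives `(ν₁ - ν₂) ⟪u, w⟫ = 0`. -/
theorem inner_eq_zero_of_mem_eigenspace {l : ℕ} {ν₁ ν₂ : ℝ} (hν : ν₁ ≠ ν₂) {u w : L2 Ω}
    (hu : u ∈ eigenspace Ω l ν₁) (hw : w ∈ eigenspace Ω l ν₂) : inner ℂ u w = 0 := by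
  obtain ⟨U, φ, hU, hφ, hφU⟩ := hu.1.exists_approx
  obtain ⟨W, ψ, hW, hψ, hψW⟩ := hw.1.exists_approx
  have h1 := sum_inner_of_mem_eigenspace hu hU hψ hψW
  have h2 := sum_inner_of_mem_eigenspace hw hW hφ hφU
  have h3 := congrArg (starRingEnd ℂ) h1
  simp only [map_sum, inner_conj_symm, map_mul, Complex.conj_ofReal] at h3
  rw [h3] at h2
  have h4 : ((ν₁ : ℂ) - ν₂) * inner ℂ u w = 0 := by linear_combination h2
  exact (mul_eq_zero.mp h4).resolve_left (sub_ne_zero.mpr (by exact_mod_cast hν))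

/-- Eigenfunctions can be chosen orthonormal, one at a time. -/
theorem exists_orthonormal_eigenfunctions {l k : ℕ} (μ : Fin k → ℝ)
    (hμ : ∀ j : Fin k, ∃ u : Fin (j + 1) → L2 Ω, LinearIndependent ℂ u ∧
      ∀ i, ∃ ν ≤ μ j, IsDirichletEigenfunction l ν (u i)) :
    ∃ (u : Fin k → L2 Ω) (ν : Fin k → ℝ), Orthonormal ℂ u ∧ (∀ j, ν j ≤ μ j) ∧
      ∀ j, u j ∈ eigenspace Ω l (ν j) := by
  induction k with
  | zero => exact ⟨Fin.elim0, Fin.elim0, ⟨fun i => i.elim0, fun i => i.elim0⟩,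
      fun i => i.elim0, fun i => i.elim0⟩
  | succ k ih =>
    obtain ⟨u, ν, hu, hν, huν⟩ := ih (fun j => μ j.castSucc) (fun j => hμ j.castSucc)
    obtain ⟨v, hv, hvν⟩ := hμ (Fin.last k)
    -- The `k + 1` independent vectors `v i` cannot all lie in the span of the `k` vectors already
    -- chosen.
    obtain ⟨i, hi⟩ : ∃ i, v i ∉ Submodule.span ℂ (Set.range u) := by
      by_contra! hcon
      have h1 : Submodule.span ℂ (Set.range v) ≤ Submodule.span ℂ (Set.range u) :=
        Submodule.span_le.mpr (by rintro _ ⟨i, rfl⟩; exact hcon i)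
      have : FiniteDimensional ℂ (Submodule.span ℂ (Set.range u)) :=
        FiniteDimensional.span_of_finite ℂ (Set.finite_range u)
      have h2 := Submodule.finrank_mono h1
      rw [finrank_span_eq_card hv] at h2
      have h3 := finrank_range_le_card (R := ℂ) u
      simp [Set.finrank] at h2 h3
      omega
    obtain ⟨κ, hκ, -, hvi⟩ := hvν i
    set w := v i - ∑ m, inner ℂ (u m) (v i) • u m with hw
    -- The projection removes only components inside the eigenspace of `κ`: the others vanish by
    -- orthogonality, so `w` is still an eigenfunction.
    have hwE : w ∈ eigenspace Ω l κ := by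
      refine Submodule.sub_mem _ hvi (Submodule.sum_mem _ fun m _ => ?_)
      by_cases hm : ν m = κ
      · exact Submodule.smul_mem _ _ (hm ▸ huν m)
      · rw [inner_eq_zero_of_mem_eigenspace hm (huν m) hvi, zero_smul]
        exact Submodule.zero_mem _
    have hw0 : w ≠ 0 := fun h0 => hi <| by
      rw [sub_eq_zero.mp (hw.symm.trans h0)]
      exact Submodule.sum_mem _ fun m _ =>
        Submodule.smul_mem _ _ (Submodule.subset_span ⟨m, rfl⟩)
    have hort : ∀ m, inner ℂ (u m) w = 0 := fun m => by
      rw [hw, inner_sub_right, hu.inner_right_fintype, sub_self]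
    refine ⟨Fin.snoc u ((‖w‖⁻¹ : ℂ) • w), Fin.snoc ν κ, ?_, ?_, ?_⟩
    · refine ⟨fun j => ?_, fun a b hab => ?_⟩
      · refine Fin.lastCases ?_ (fun j => ?_) j
        · simp [norm_smul, hw0]
        · simpa using hu.1 j
      · have hx : ∀ m, inner ℂ (u m) ((‖w‖⁻¹ : ℂ) • w) = 0 := fun m => by
          rw [inner_smul_right, hort, mul_zero]
        revert hab
        refine Fin.lastCases ?_ (fun a => ?_) a <;> refine Fin.lastCases ?_ (fun b => ?_) b
        · simp
        · intro _
          beta_reduce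
          rw [Fin.snoc_last, Fin.snoc_castSucc, ← inner_conj_symm, hx, map_zero]
        · intro _
          beta_reduce
          rw [Fin.snoc_last, Fin.snoc_castSucc, hx]
        · intro hab
          beta_reduce
          rw [Fin.snoc_castSucc, Fin.snoc_castSucc]
          exact hu.2 fun h => hab (by rw [h])
    · intro j
      refine Fin.lastCases ?_ (fun j => ?_) j
      · simpa using hκ
      · simpa using hν j
    · intro j
      refine Fin.lastCases ?_ (fun j => ?_) j
      · simpa using Submodule.smul_mem _ _ hwE
      · simpa using huν j

end

/-! ### The Fourier transform on `L²(Ω)`: Plancherel, energy and Bessel -/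

section

variable {n : ℕ} {Ω : Opens (EuclideanSpace ℝ (Fin n))}
  [IsFiniteMeasure ((volume : Measure (EuclideanSpace ℝ (Fin n))).restrict Ω)]

theorem memLp_planeWave (ξ : EuclideanSpace ℝ (Fin n)) :
    MemLp (fun x : EuclideanSpace ℝ (Fin n) =>
        Complex.exp ((2 * Real.pi * inner ℝ x ξ : ℝ) * Complex.I)) 2
      ((volume : Measure (EuclideanSpace ℝ (Fin n))).restrict Ω) :=
  MemLp.of_bound (by fun_prop) 1
    (.of_forall fun x => (Complex.norm_exp_ofReal_mul_I _).le)

variable (Ω) in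
/-- The plane wave `x ↦ exp(2πi x·ξ)` in `L²(Ω)`. -/
def planeWave (ξ : EuclideanSpace ℝ (Fin n)) : L2 Ω := (memLp_planeWave ξ).toLp

theorem enorm_planeWave_sq (ξ : EuclideanSpace ℝ (Fin n)) :
    ‖planeWave Ω ξ‖ₑ ^ 2 = (volume : Measure (EuclideanSpace ℝ (Fin n))) Ω := by
  rw [planeWave, Lp.enorm_toLp, eLpNorm_congr_norm_ae (g := fun _ => (1 : ℝ))
    (.of_forall fun x => by rw [Complex.norm_exp_ofReal_mul_I]; simp)]
  rw [eLpNorm_const' _ (by simp) (by simp), ← ENNReal.rpow_natCast,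
    ENNReal.mul_rpow_of_nonneg _ _ (by simp), ← ENNReal.rpow_mul]
  simp

/-- The Fourier transform of (the extension by zero of) a function of `L²(Ω)`. -/
def fourierL2 (f : L2 Ω) (ξ : EuclideanSpace ℝ (Fin n)) : ℂ := inner ℂ (planeWave Ω ξ) f

theorem fourierL2_toL2 (φ : 𝓓(Ω, ℂ)) (ξ : EuclideanSpace ℝ (Fin n)) :
    fourierL2 (toL2 φ) ξ = 𝓕 (toSchwartz φ) ξ := by
  rw [SchwartzMap.fourier_coe, Real.fourier_eq', fourierL2, L2.inner_def]
  refine Eq.trans ?_ (setIntegral_eq_integral_of_forall_compl_eq_zero (s := (Ω : Set _)) ?_)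
  · refine integral_congr_ae ?_
    filter_upwards [coeFn_toL2 φ, (memLp_planeWave (Ω := Ω) ξ).coeFn_toLp] with x hx hx'
    rw [hx, planeWave, hx', RCLike.inner_apply, ← Complex.exp_conj, map_mul,
      Complex.conj_ofReal, Complex.conj_I, smul_eq_mul, mul_comm]
    simp
  · intro x hx
    have : φ x = 0 := image_eq_zero_of_notMem_tsupport fun hxs => hx (φ.tsupport_subset hxs)
    simp [this]

/-- Plane waves belong to `L²(Ω)` because `Ω` has finite measure, so convergence in `L²(Ω)` forces
convergence of the transforms at every frequency. -/
theorem tendsto_fourierL2 {φ : ℕ → 𝓓(Ω, ℂ)} {f : L2 Ω}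
    (h : Tendsto (fun i => toL2 (φ i)) atTop (𝓝 f)) (ξ : EuclideanSpace ℝ (Fin n)) :
    Tendsto (fun i => 𝓕 (toSchwartz (φ i)) ξ) atTop (𝓝 (fourierL2 f ξ)) := by
  simp only [← fourierL2_toL2]
  exact tendsto_const_nhds.inner h

theorem fourierL2_partialDeriv {m : ℕ} {α : Fin m → Fin n} {φ : ℕ → 𝓓(Ω, ℂ)} {u v : L2 Ω}
    (hu : Tendsto (fun i => toL2 (φ i)) atTop (𝓝 u))
    (hv : Tendsto (fun i => toL2 (partialDeriv α (φ i))) atTop (𝓝 v))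
    (ξ : EuclideanSpace ℝ (Fin n)) :
    fourierL2 v ξ = symbol α ξ * fourierL2 u ξ := by
  refine tendsto_nhds_unique (tendsto_fourierL2 hv ξ) ?_
  simp only [toSchwartz_partialDeriv, fourier_iteratedLineDerivOp_single]
  exact (tendsto_fourierL2 hu ξ).const_mul _

/-- Plancherel passes from test functions to their `L²` limits: the transforms form a Cauchy
sequence in `L²(ℝⁿ)`, and its limit has the right norm. -/
theorem exists_ae_eq_fourierL2 {φ : ℕ → 𝓓(Ω, ℂ)} {f : L2 Ω}
    (h : Tendsto (fun i => toL2 (φ i)) atTop (𝓝 f)) :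
    ∃ g : Lp ℂ 2 (volume : Measure (EuclideanSpace ℝ (Fin n))),
      fourierL2 f =ᵐ[volume] g ∧ ‖g‖ = ‖f‖ := by
  set F : ℕ → Lp ℂ 2 (volume : Measure (EuclideanSpace ℝ (Fin n))) :=
    fun i => (𝓕 (toSchwartz (φ i))).toLp 2 with hF
  have hn : ∀ i, ‖F i‖ = ‖toL2 (φ i)‖ := fun i => by
    rw [hF, ← norm_toLp_toSchwartz]
    exact norm_fourier_toL2_eq _
  have hd : ∀ i j, dist (F i) (F j) = dist (toL2 (φ i)) (toL2 (φ j)) := fun i j => by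
    rw [dist_eq_norm, dist_eq_norm, ← toL2_sub, ← norm_toLp_toSchwartz,
      ← norm_fourier_toL2_eq, sub_eq_add_neg (φ i)]
    have h1 : toSchwartz (φ i + -φ j) = toSchwartz (φ i) + -toSchwartz (φ j) := rfl
    rw [h1, FourierTransform.fourier_add, FourierTransform.fourier_neg, ← sub_eq_add_neg]
    rfl
  have hc : CauchySeq F := by
    have := h.cauchySeq
    rw [Metric.cauchySeq_iff] at this ⊢
    simpa only [hd] using this
  obtain ⟨g, hg⟩ := cauchySeq_tendsto_of_complete hc
  refine ⟨g, ?_, ?_⟩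
  -- A subsequence converges almost everywhere to `g`, and everywhere to `fourierL2 f`.
  · obtain ⟨ns, hns, hae⟩ := (tendstoInMeasure_of_tendsto_Lp hg).exists_seq_tendsto_ae
    have hall : ∀ᵐ ξ ∂(volume : Measure (EuclideanSpace ℝ (Fin n))), ∀ i,
        F i ξ = 𝓕 (toSchwartz (φ i)) ξ := ae_all_iff.mpr fun i => SchwartzMap.coeFn_toLp _ _ _
    filter_upwards [hae, hall] with ξ h1 h2
    simp only [h2] at h1
    exact tendsto_nhds_unique ((tendsto_fourierL2 h ξ).comp hns.tendsto_atTop) h1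
  · have h1 := hg.norm
    simp only [hn] at h1
    exact tendsto_nhds_unique h1 h.norm

theorem aestronglyMeasurable_fourierL2 {φ : ℕ → 𝓓(Ω, ℂ)} {f : L2 Ω}
    (h : Tendsto (fun i => toL2 (φ i)) atTop (𝓝 f)) :
    AEStronglyMeasurable (fourierL2 f) volume := by
  obtain ⟨g, hg, -⟩ := exists_ae_eq_fourierL2 h
  exact (Lp.aestronglyMeasurable g).congr hg.symm

theorem lintegral_enorm_fourierL2_sq {φ : ℕ → 𝓓(Ω, ℂ)} {f : L2 Ω}
    (h : Tendsto (fun i => toL2 (φ i)) atTop (𝓝 f)) :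
    ∫⁻ ξ, ‖fourierL2 f ξ‖ₑ ^ 2 = ‖f‖ₑ ^ 2 := by
  obtain ⟨g, hg, hgn⟩ := exists_ae_eq_fourierL2 h
  have h1 : ‖g‖ₑ = ‖f‖ₑ := by rw [← ofReal_norm, ← ofReal_norm, hgn]
  have h2 := eLpNorm_nnreal_pow_eq_lintegral (f := g)
    (μ := (volume : Measure (EuclideanSpace ℝ (Fin n)))) (p := 2) (by norm_num)
  rw [← h1, Lp.enorm_def]
  simp only [NNReal.coe_ofNat, ENNReal.coe_ofNat, ENNReal.rpow_ofNat] at h2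
  rw [h2]
  refine lintegral_congr_ae ?_
  filter_upwards [hg] with ξ hξ
  rw [hξ]

theorem aestronglyMeasurable_fourierL2_of_mem {l : ℕ} {ν : ℝ} {u : L2 Ω}
    (hu : u ∈ eigenspace Ω l ν) : AEStronglyMeasurable (fourierL2 u) volume := by
  obtain ⟨U, φ, hU, hφ, hφU⟩ := hu.1.exists_approx
  exact aestronglyMeasurable_fourierL2 hφ

theorem lintegral_enorm_fourierL2_sq_of_mem {l : ℕ} {ν : ℝ} {u : L2 Ω}
    (hu : u ∈ eigenspace Ω l ν) : ∫⁻ ξ, ‖fourierL2 u ξ‖ₑ ^ 2 = ‖u‖ₑ ^ 2 := by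
  obtain ⟨U, φ, hU, hφ, hφU⟩ := hu.1.exists_approx
  exact lintegral_enorm_fourierL2_sq hφ

/-- The energy of a normalized eigenfunction, on the Fourier side, is its eigenvalue. -/
theorem lintegral_energy_of_mem_eigenspace {l : ℕ} {ν : ℝ} {u : L2 Ω}
    (hu : u ∈ eigenspace Ω l ν) (hnorm : ‖u‖ = 1) :
    ∫⁻ ξ : EuclideanSpace ℝ (Fin n),
      ENNReal.ofReal ((2 * Real.pi * ‖ξ‖) ^ (2 * l)) * ‖fourierL2 u ξ‖ₑ ^ 2 =
        ENNReal.ofReal ν := by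
  obtain ⟨U, φ, hU, hφ, hφU⟩ := hu.1.exists_approx
  -- The equation is tested against `u` itself.
  have h1 := sum_inner_of_mem_eigenspace hu hU hφ hφU
  have h2 : ∑ α, ‖U α‖ ^ 2 = ν := by
    simp only [inner_self_eq_norm_sq_to_K, hnorm] at h1
    exact_mod_cast (by simpa using h1 : ∑ α, ((‖U α‖ : ℂ)) ^ 2 = ν)
  rw [← h2, ENNReal.ofReal_sum_of_nonneg fun _ _ => by positivity]
  have h3 : ∀ α, ENNReal.ofReal (‖U α‖ ^ 2) = ∫⁻ ξ, ‖fourierL2 (U α) ξ‖ₑ ^ 2 := fun α => by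
    rw [lintegral_enorm_fourierL2_sq (hφU α), ENNReal.ofReal_pow (norm_nonneg _), ofReal_norm]
  simp only [h3]
  rw [← lintegral_finsetSum' _ fun α _ =>
    (aestronglyMeasurable_fourierL2 (hφU α)).enorm.pow_const 2]
  refine lintegral_congr fun ξ => ?_
  rw [← sum_norm_symbol_sq]
  simp only [fourierL2_partialDeriv hφ (hφU _), enorm_mul, mul_pow]
  rw [← Finset.sum_mul, ENNReal.ofReal_sum_of_nonneg fun _ _ => by positivity]
  simp only [ENNReal.ofReal_pow (norm_nonneg _), ofReal_norm]

/-- Bessel's inequality for the plane waves. -/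
theorem sum_enorm_fourierL2_sq_le {k : ℕ} {u : Fin k → L2 Ω} (hu : Orthonormal ℂ u)
    (ξ : EuclideanSpace ℝ (Fin n)) :
    ∑ j, ‖fourierL2 (u j) ξ‖ₑ ^ 2 ≤ (volume : Measure (EuclideanSpace ℝ (Fin n))) Ω := by
  rw [← enorm_planeWave_sq (Ω := Ω) ξ]
  have h := hu.sum_inner_products_le (planeWave Ω ξ) (s := Finset.univ)
  have h' := ENNReal.ofReal_le_ofReal h
  rw [ENNReal.ofReal_sum_of_nonneg fun _ _ => by positivity] at h'
  simp only [ENNReal.ofReal_pow (norm_nonneg _), ofReal_norm] at h'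
  refine le_trans (le_of_eq (Finset.sum_congr rfl fun j _ => ?_)) h'
  rw [fourierL2, ← ofReal_norm, ← ofReal_norm, norm_inner_symm]

end

/-! ### Jensen, the bathtub principle and the explicit constant -/

section

/-- Jensen's inequality for the concave function `x ↦ x ^ q` and a probability density `ρ`. -/
theorem lintegral_rpow_mul_le {X : Type*} [MeasurableSpace X] {μ : Measure X}
    {W ρ : X → ℝ≥0∞} (hW : AEMeasurable W μ) (hρ : AEMeasurable ρ μ) (hρ1 : ∫⁻ x, ρ x ∂μ = 1)
    {q : ℝ} (hq : 0 ≤ q) (hq1 : q ≤ 1) :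
    ∫⁻ x, W x ^ q * ρ x ∂μ ≤ (∫⁻ x, W x * ρ x ∂μ) ^ q := by
  -- Hölder with weights `q` and `1 - q`, applied to `W ρ` and `ρ`.
  have h := ENNReal.lintegral_mul_norm_pow_le (hW.mul hρ) hρ hq (sub_nonneg.mpr hq1) (by ring)
  rw [hρ1, ENNReal.one_rpow, mul_one] at h
  refine le_trans (le_of_eq (lintegral_congr fun x => ?_)) h
  rw [Pi.mul_apply, ENNReal.mul_rpow_of_nonneg _ _ hq, mul_assoc,
    ← ENNReal.rpow_add_of_nonneg _ _ hq (sub_nonneg.mpr hq1)]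
  simp

/-- The bathtub principle: among the densities `F ≤ M` of given mass, the one concentrated
where the weight `W` is small has the least weighted mass. -/
theorem mul_setLIntegral_le_lintegral_mul {X : Type*} [MeasurableSpace X] {μ : Measure X}
    {F W : X → ℝ≥0∞} {B : Set X} {c M : ℝ≥0∞} (hB : MeasurableSet B) (hW : Measurable W)
    (hF : AEMeasurable F μ) (hWB : ∀ x ∈ B, W x ≤ c) (hWB' : ∀ x ∉ B, c ≤ W x)
    (hFM : ∀ x, F x ≤ M) (hc : c ≠ ∞) (hint : ∫⁻ x, F x ∂μ = M * μ B) (hfin : M * μ B ≠ ∞) :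
    M * ∫⁻ x in B, W x ∂μ ≤ ∫⁻ x, W x * F x ∂μ := by
  -- This is `(c - W) (M 1_B - F) ≥ 0`, rearranged to avoid subtraction in `ℝ≥0∞`.
  have key : ∀ x, B.indicator (fun x => M * W x) x + c * F x ≤
      W x * F x + B.indicator (fun _ => c * M) x := fun x => by
    by_cases hx : x ∈ B
    · obtain ⟨d, hd⟩ := exists_add_of_le (hWB x hx)
      simp only [Set.indicator_of_mem hx, hd]
      calc M * W x + (W x + d) * F x = W x * F x + (W x * M + d * F x) := by ring
        _ ≤ W x * F x + (W x * M + d * M) := by gcongr; exact hFM x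
        _ = _ := by ring
    · simp only [Set.indicator_of_notMem hx, zero_add, add_zero]
      gcongr
      exact hWB' x hx
  have hWF : AEMeasurable (fun x => W x * F x) μ := hW.aemeasurable.mul hF
  have h := lintegral_mono (μ := μ) key
  rw [lintegral_add_left ((hW.const_mul M).indicator hB),
    lintegral_add_left' hWF, lintegral_indicator hB, lintegral_indicator hB,
    lintegral_const_mul _ hW, lintegral_const_mul'' _ hF, hint, setLIntegral_const,
    mul_assoc c M] at h
  exact (ENNReal.add_le_add_iff_right (ENNReal.mul_ne_top hc hfin)).mp h

/-- Polar coordinates reduce the integral to `n ω ∫₀ᴿ r ^ (n - 1 + s) dr`, with `ω` the volume of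
the unit ball. -/
theorem setLIntegral_ball_norm_rpow {n : ℕ} (hn : 0 < n) {s R : ℝ} (hs : 0 ≤ s) (hR : 0 ≤ R) :
    ∫⁻ x in Metric.ball (0 : EuclideanSpace ℝ (Fin n)) R, ENNReal.ofReal (‖x‖ ^ s) =
      ENNReal.ofReal (n / (n + s) *
        (volume : Measure (EuclideanSpace ℝ (Fin n))).real (Metric.ball 0 1) *
          R ^ ((n : ℝ) + s)) := by
  have : Nonempty (Fin n) := ⟨⟨0, hn⟩⟩
  have hcont : Continuous fun x : EuclideanSpace ℝ (Fin n) => ‖x‖ ^ s :=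
    continuous_norm.rpow_const fun _ => Or.inr hs
  have hint : IntegrableOn (fun x : EuclideanSpace ℝ (Fin n) => ‖x‖ ^ s) (Metric.ball 0 R) :=
    (hcont.continuousOn.integrableOn_compact (isCompact_closedBall 0 R)).mono_set
      Metric.ball_subset_closedBall
  rw [← ofReal_integral_eq_lintegral_ofReal hint (.of_forall fun x => by positivity)]
  congr 1
  have h := integral_fun_norm_addHaar (volume : Measure (EuclideanSpace ℝ (Fin n)))
    ((Set.Iio R).indicator fun y : ℝ => y ^ s)
  have h1 : ∀ x : EuclideanSpace ℝ (Fin n), (Set.Iio R).indicator (fun y : ℝ => y ^ s) ‖x‖ =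
      (Metric.ball 0 R).indicator (fun x : EuclideanSpace ℝ (Fin n) => ‖x‖ ^ s) x := fun x => by
    simp [Set.indicator]
  simp only [h1] at h
  rw [integral_indicator Metric.isOpen_ball.measurableSet] at h
  rw [h, finrank_euclideanSpace_fin]
  have h2 : ∫ y in Set.Ioi (0 : ℝ), y ^ (n - 1) • (Set.Iio R).indicator (fun y : ℝ => y ^ s) y =
      ∫ y in (0 : ℝ)..R, y ^ ((n : ℝ) - 1 + s) := by
    have h3 : ∀ y ∈ Set.Ioi (0 : ℝ),
        y ^ (n - 1) • (Set.Iio R).indicator (fun y : ℝ => y ^ s) y =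
          (Set.Iio R).indicator (fun y : ℝ => y ^ ((n : ℝ) - 1 + s)) y := fun y hy => by
      by_cases hyR : y ∈ Set.Iio R
      · rw [Set.indicator_of_mem hyR, Set.indicator_of_mem hyR, smul_eq_mul,
          Real.rpow_add hy, ← Real.rpow_natCast, Nat.cast_sub hn, Nat.cast_one]
      · rw [Set.indicator_of_notMem hyR, Set.indicator_of_notMem hyR, smul_zero]
    rw [setIntegral_congr_fun measurableSet_Ioi h3, setIntegral_indicator measurableSet_Iio,
      Set.Ioi_inter_Iio, ← integral_Ioc_eq_integral_Ioo,
      ← intervalIntegral.integral_of_le hR]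
  have hn' : (0 : ℝ) < n := by exact_mod_cast hn
  rw [h2, integral_rpow (Or.inl (by linarith)),
    Real.zero_rpow (by linarith)]
  rw [show (n : ℝ) - 1 + s + 1 = n + s by ring, nsmul_eq_mul, smul_eq_mul]
  ring

variable {n : ℕ} {Ω : Opens (EuclideanSpace ℝ (Fin n))}

/-- The value of the bathtub bound on the ball of volume `k / |Ω|`. -/
theorem bathtub_constant (hn : 0 < n) {M s k G : ℝ} (hM : 0 < M) (hk : 0 < k) (hG : 0 < G)
    (hs : 0 ≤ s) {ω R : ℝ} (hω : ω = √Real.pi ^ n / G)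
    (hR : R = (k / (M * ω)) ^ (1 / (n : ℝ))) :
    M * ((2 * Real.pi) ^ s * (n / (n + s) * ω * R ^ ((n : ℝ) + s))) =
      n / (n + s) * (4 * Real.pi) ^ (s / 2) * (G / M) ^ (s / n) * k ^ (1 + s / n) := by
  have hn' : (0 : ℝ) < n := by exact_mod_cast hn
  have hπ := Real.pi_pos
  have hω0 : 0 < ω := by rw [hω]; positivity
  have hb : 0 < k / (M * ω) := by positivity
  have h1 : R ^ ((n : ℝ) + s) = k / (M * ω) * (k / (M * ω)) ^ (s / n) := by
    rw [hR, ← Real.rpow_mul hb.le, show 1 / (n : ℝ) * (n + s) = 1 + s / n by field_simp,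
      Real.rpow_add hb, Real.rpow_one]
  have h2 : k / (M * ω) = k * (G / M) * (Real.pi ^ ((n : ℝ) / 2))⁻¹ := by
    rw [hω, Real.sqrt_eq_rpow, ← Real.rpow_natCast, ← Real.rpow_mul hπ.le,
      show 1 / 2 * (n : ℝ) = n / 2 by ring]
    field_simp
  have h3 : (k / (M * ω)) ^ (s / n) = k ^ (s / n) * (G / M) ^ (s / n) * (Real.pi ^ (s / 2))⁻¹ := by
    rw [h2, Real.mul_rpow (by positivity) (by positivity),
      Real.mul_rpow (by positivity) (by positivity), Real.inv_rpow (by positivity),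
      ← Real.rpow_mul hπ.le, show (n : ℝ) / 2 * (s / n) = s / 2 by field_simp]
  have h4 : (2 * Real.pi) ^ s = (4 * Real.pi) ^ (s / 2) * Real.pi ^ (s / 2) := by
    rw [← Real.mul_rpow (by positivity) (by positivity),
      show 4 * Real.pi * Real.pi = (2 * Real.pi) ^ (2 : ℝ) by
        rw [Real.rpow_two]; ring,
      ← Real.rpow_mul (by positivity), show 2 * (s / 2) = s by ring]
  have h5 : k ^ (1 + s / n) = k * k ^ (s / n) := by
    rw [Real.rpow_add hk, Real.rpow_one]
  have hπs : Real.pi ^ (s / 2) ≠ 0 := by positivity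
  rw [h1, h3, h4, h5]
  field_simp

/-! ### The bound for orthonormal eigenfunctions -/

/-- The lower bound for orthonormal eigenfunctions. -/
theorem le_sum_rpow_of_orthonormal (hn : 0 < n) {l : ℕ} {q : ℝ} (hq : 0 < q) (hq1 : q ≤ 1)
    (hΩ : (Ω : Set (EuclideanSpace ℝ (Fin n))).Nonempty)
    (hΩfin : (volume : Measure (EuclideanSpace ℝ (Fin n))) Ω ≠ ∞)
    {k : ℕ} (hk : 0 < k) {u : Fin k → L2 Ω} {ν : Fin k → ℝ} (hu : Orthonormal ℂ u)
    (huν : ∀ j, u j ∈ eigenspace Ω l (ν j)) :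
    ENNReal.ofReal
        ((n : ℝ) / (n + 2 * l * q) * (4 * Real.pi) ^ ((l : ℝ) * q) *
          (Real.Gamma (1 + (n : ℝ) / 2) /
            (volume : Measure (EuclideanSpace ℝ (Fin n))).real Ω) ^ (2 * l * q / (n : ℝ)) *
          (k : ℝ) ^ (1 + 2 * l * q / (n : ℝ)))
      ≤ ∑ j, ENNReal.ofReal (ν j) ^ q := by
  have : Nonempty (Fin n) := ⟨⟨0, hn⟩⟩
  have : IsFiniteMeasure ((volume : Measure (EuclideanSpace ℝ (Fin n))).restrict Ω) :=
    ⟨by simpa using hΩfin.lt_top⟩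
  have hn' : (0 : ℝ) < n := by exact_mod_cast hn
  have hk' : (0 : ℝ) < k := by exact_mod_cast hk
  have hπ := Real.pi_pos
  set M := (volume : Measure (EuclideanSpace ℝ (Fin n))).real Ω with hMdef
  have hM : 0 < M := ENNReal.toReal_pos (Ω.isOpen.measure_pos volume hΩ).ne' hΩfin
  have hMe : (volume : Measure (EuclideanSpace ℝ (Fin n))) Ω = ENNReal.ofReal M :=
    (ENNReal.ofReal_toReal hΩfin).symm
  set G := Real.Gamma (1 + (n : ℝ) / 2) with hGdef
  have hG : 0 < G := Real.Gamma_pos_of_pos (by positivity)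
  set s : ℝ := 2 * l * q with hsdef
  have hs : 0 ≤ s := by positivity
  set ω := (volume : Measure (EuclideanSpace ℝ (Fin n))).real (Metric.ball 0 1) with hωdef
  have hω : ω = √Real.pi ^ n / G := by
    rw [hωdef, Measure.real, EuclideanSpace.volume_ball, hGdef, add_comm (1 : ℝ)]
    simp only [ENNReal.ofReal_one, one_pow, one_mul, Fintype.card_fin]
    rw [ENNReal.toReal_ofReal]
    have : 0 < Real.Gamma ((n : ℝ) / 2 + 1) := Real.Gamma_pos_of_pos (by positivity)
    positivity
  have hω0 : 0 < ω := by rw [hω]; positivity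
  -- The radius for which the density `M` on the ball has total mass `k`.
  set R : ℝ := (k / (M * ω)) ^ (1 / (n : ℝ)) with hR
  have hR0 : 0 ≤ R := by positivity
  have hRn : M * (R ^ n * ω) = k := by
    rw [hR, ← Real.rpow_natCast, ← Real.rpow_mul (by positivity), one_div,
      inv_mul_cancel₀ hn'.ne', Real.rpow_one]
    field_simp
  have hball : (volume : Measure (EuclideanSpace ℝ (Fin n))) (Metric.ball 0 R) =
      ENNReal.ofReal (R ^ n * ω) := by
    rw [Measure.addHaar_ball _ _ hR0, finrank_euclideanSpace_fin, ENNReal.ofReal_mul (by positivity),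
      hωdef, ofReal_measureReal (measure_ball_lt_top.ne)]
  let W : EuclideanSpace ℝ (Fin n) → ℝ≥0∞ := fun ξ => ENNReal.ofReal ((2 * Real.pi * ‖ξ‖) ^ s)
  have hWm : Measurable W := by
    have : Continuous fun ξ : EuclideanSpace ℝ (Fin n) => (2 * Real.pi * ‖ξ‖) ^ s :=
      (continuous_const.mul continuous_norm).rpow_const fun _ => Or.inr hs
    exact this.measurable.ennreal_ofReal
  have hρm : ∀ j, AEMeasurable (fun ξ => ‖fourierL2 (u j) ξ‖ₑ ^ 2)
      (volume : Measure (EuclideanSpace ℝ (Fin n))) := fun j =>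
    (aestronglyMeasurable_fourierL2_of_mem (huν j)).enorm.pow_const 2
  have hρ1 : ∀ j, ∫⁻ ξ, ‖fourierL2 (u j) ξ‖ₑ ^ 2 = 1 := fun j => by
    rw [lintegral_enorm_fourierL2_sq_of_mem (huν j), ← ofReal_norm, hu.1 j]
    simp
  have hjensen : ∀ j, ∫⁻ ξ, W ξ * ‖fourierL2 (u j) ξ‖ₑ ^ 2 ≤ ENNReal.ofReal (ν j) ^ q := fun j => by
    rw [← lintegral_energy_of_mem_eigenspace (huν j) (hu.1 j)]
    have hm : Measurable fun ξ : EuclideanSpace ℝ (Fin n) =>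
        ENNReal.ofReal ((2 * Real.pi * ‖ξ‖) ^ (2 * l)) := by fun_prop
    refine le_trans (le_of_eq (lintegral_congr fun ξ => ?_))
      (lintegral_rpow_mul_le hm.aemeasurable (hρm j) (hρ1 j) hq.le hq1)
    rw [ENNReal.ofReal_rpow_of_nonneg (by positivity) hq.le, ← Real.rpow_natCast,
      ← Real.rpow_mul (by positivity)]
    simp [W, hsdef]
  refine le_trans ?_ (Finset.sum_le_sum fun j _ => hjensen j)
  have hWρm : ∀ j, AEMeasurable (fun ξ => W ξ * ‖fourierL2 (u j) ξ‖ₑ ^ 2)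
      (volume : Measure (EuclideanSpace ℝ (Fin n))) := fun j => hWm.aemeasurable.mul (hρm j)
  rw [← lintegral_finsetSum' _ fun j _ => hWρm j]
  simp only [← Finset.mul_sum]
  have hmass : ∫⁻ ξ, ∑ j, ‖fourierL2 (u j) ξ‖ₑ ^ 2 =
      ENNReal.ofReal M * (volume : Measure (EuclideanSpace ℝ (Fin n))) (Metric.ball 0 R) := by
    rw [lintegral_finsetSum' _ fun j _ => hρm j, hball, ← ENNReal.ofReal_mul hM.le, hRn]
    simp [hρ1]
  -- The threshold `c` is the value of the radial weight `W` on the sphere of radius `R`.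
  have hbath := mul_setLIntegral_le_lintegral_mul (c := ENNReal.ofReal ((2 * Real.pi * R) ^ s))
    Metric.isOpen_ball.measurableSet hWm (Finset.aemeasurable_fun_sum _ fun j _ => hρm j)
    (fun ξ hξ => ENNReal.ofReal_le_ofReal (Real.rpow_le_rpow (by positivity)
      (by gcongr; exact (mem_ball_zero_iff.mp hξ).le) hs))
    (fun ξ hξ => ENNReal.ofReal_le_ofReal (Real.rpow_le_rpow (by positivity)
      (by gcongr; exact not_lt.mp fun h => hξ (mem_ball_zero_iff.mpr h)) hs))
    (fun ξ => (sum_enorm_fourierL2_sq_le hu ξ).trans_eq hMe) ENNReal.ofReal_ne_top hmass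
    (ENNReal.mul_ne_top ENNReal.ofReal_ne_top measure_ball_lt_top.ne)
  refine le_trans (le_of_eq ?_) hbath
  have hWi : ∀ ξ, W ξ = ENNReal.ofReal ((2 * Real.pi) ^ s) * ENNReal.ofReal (‖ξ‖ ^ s) := fun ξ => by
    rw [← ENNReal.ofReal_mul (by positivity), ← Real.mul_rpow (by positivity) (norm_nonneg _)]
  simp only [hWi]
  rw [lintegral_const_mul' _ _ ENNReal.ofReal_ne_top, setLIntegral_ball_norm_rpow hn hs hR0,
    ← ENNReal.ofReal_mul (by positivity), ← ENNReal.ofReal_mul hM.le,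
    bathtub_constant hn hM hk' hG hs hω hR, show s / 2 = (l : ℝ) * q by rw [hsdef]; ring]

end

end Polyharmonic
end

/-! ### From orthonormal eigenfunctions to the eigenvalues -/

theorem corollary1p3 (n : ℕ) (hn : 2 ≤ n) (l : ℕ) (hl : 1 ≤ l) (q : ℝ) (hq : 0 < q) (hq1 : q ≤ 1)
    (Ω : Opens (EuclideanSpace ℝ (Fin n)))
    (hΩ : IsConnected (Ω : Set (EuclideanSpace ℝ (Fin n))))
    (hΩb : Bornology.IsBounded (Ω : Set (EuclideanSpace ℝ (Fin n))))
    (k : ℕ) :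
    ENNReal.ofReal
        ((n : ℝ) / (n + 2 * l * q) * (4 * Real.pi) ^ ((l : ℝ) * q) *
          (Real.Gamma (1 + (n : ℝ) / 2) /
            (volume : Measure (EuclideanSpace ℝ (Fin n))).real Ω) ^ (2 * l * q / (n : ℝ)) *
          (k : ℝ) ^ (1 + 2 * l * q / (n : ℝ)))
      ≤ ∑ j ∈ Finset.Icc 1 k, Polyharmonic.dirichletEigenvalue Ω l j ^ q := by
  rcases Nat.eq_zero_or_pos k with rfl | hk
  · rw [Nat.cast_zero, Real.zero_rpow (by positivity)]
    simp
  have hsum : ∑ j ∈ Finset.Icc 1 k, Polyharmonic.dirichletEigenvalue Ω l j ^ q =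
      ∑ j : Fin k, Polyharmonic.dirichletEigenvalue Ω l (j + 1) ^ q := by
    rw [Fin.sum_univ_eq_sum_range (fun j => Polyharmonic.dirichletEigenvalue Ω l (j + 1) ^ q) k,
      Finset.range_eq_Ico,
      Finset.sum_Ico_add' (fun j => Polyharmonic.dirichletEigenvalue Ω l j ^ q) 0 k 1, zero_add]
    rfl
  rw [hsum]
  by_cases htop : ∃ j : Fin k, Polyharmonic.dirichletEigenvalue Ω l (j + 1) = ∞
  · obtain ⟨j, hj⟩ := htop
    rw [ENNReal.sum_eq_top.mpr ⟨j, Finset.mem_univ j, by rw [hj, ENNReal.top_rpow_of_pos hq]⟩]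
    exact le_top
  push Not at htop
  -- The infimum defining an eigenvalue is not known to be attained, so the bound is proved with
  -- every eigenvalue raised by `ε > 0`, and then `ε → 0`.
  have hlim : Tendsto (fun ε : ℝ≥0∞ => ∑ j : Fin k,
      (Polyharmonic.dirichletEigenvalue Ω l (j + 1) + ε) ^ q) (𝓝[>] 0)
      (𝓝 (∑ j : Fin k, Polyharmonic.dirichletEigenvalue Ω l (j + 1) ^ q)) := by
    have hc : Continuous fun ε : ℝ≥0∞ => ∑ j : Fin k,
        (Polyharmonic.dirichletEigenvalue Ω l (j + 1) + ε) ^ q :=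
      continuous_finsetSum _ fun j _ =>
        ENNReal.continuous_rpow_const.comp (continuous_const.add continuous_id)
    simpa using (hc.tendsto 0).mono_left nhdsWithin_le_nhds
  refine ge_of_tendsto hlim ?_
  filter_upwards [self_mem_nhdsWithin] with ε hε
  have hex : ∀ j : Fin k, ∃ μ : ℝ, (∃ u : Fin (j + 1) → Polyharmonic.L2 Ω, LinearIndependent ℂ u ∧
      ∀ i, ∃ ν ≤ μ, Polyharmonic.IsDirichletEigenfunction l ν (u i)) ∧
      ENNReal.ofReal μ ≤ Polyharmonic.dirichletEigenvalue Ω l (j + 1) + ε := fun j => by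
    have hlt : Polyharmonic.dirichletEigenvalue Ω l (j + 1) <
        Polyharmonic.dirichletEigenvalue Ω l (j + 1) + ε :=
      ENNReal.lt_add_right (htop j) (ne_of_gt hε)
    nth_rw 1 [Polyharmonic.dirichletEigenvalue] at hlt
    obtain ⟨μ, hμ⟩ := iInf_lt_iff.mp hlt
    obtain ⟨hu, hμ'⟩ := iInf_lt_iff.mp hμ
    exact ⟨μ, hu, hμ'.le⟩
  choose μ hμ hμle using hex
  obtain ⟨u, ν, hu, hν, huν⟩ := Polyharmonic.exists_orthonormal_eigenfunctions μ hμ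
  refine (Polyharmonic.le_sum_rpow_of_orthonormal (by omega) hq hq1 hΩ.nonempty
    hΩb.measure_lt_top.ne hk hu huν).trans (Finset.sum_le_sum fun j _ => ?_)
  exact ENNReal.rpow_le_rpow ((ENNReal.ofReal_le_ofReal (hν j)).trans (hμle j)) hq.le
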